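/- Let $p \ge 3$ be a prime and let $K = \mathbb{Q}_p(\zeta_p)$, where $\zeta_p$ is a primitive $p$-th root of unity, with the absolute value extending that of $\mathbb{Q}_p$. Let $\mathcal{O}_K$ be the ring of integers of $K$ (the integral closure of $\mathbb{Z}_p$ in $K$) and let $\mathfrak{m}_K$ be the maximal ideal of $\mathcal{O}_K$. Then the series \[ \log_p(1+x) = \sum_{n \ge 1} (-1)^{n-1}\,\frac{x^n}{n} = x - \frac{x^2}{2} + \frac{x^3}{3} - \cdots \] converges in $K$ for every $x \in \mathfrak{m}_K$, and the image of $(1+\mathfrak{m}_K) \setminus (1+\mathfrak{m}_K^2)$ under $\log_p$ is exactly $\mathfrak{m}_K^2$: \[ \log_p\bigl((1+\mathfrak{m}_K) \setminus (1+\mathfrak{m}_K^2)\bigr) = \mathfrak{m}_K^2 . \] -/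

import Mathlib

/-- The power series `x - x ^ 2 / 2 + x ^ 3 / 3 - ⋯` of `log (1 + x)`: its term of degree `n + 1`. -/
def padicLogTerm {K : Type*} [Field K] (x : K) (n : ℕ) : K :=
  (-1) ^ n * x ^ (n + 1) / ((n : K) + 1)

/-- The `p`-adic logarithm `log (1 + x) = x - x ^ 2 / 2 + x ^ 3 / 3 - ⋯`, as a function of
`a = 1 + x`; it is meaningful where the series converges. -/
noncomputable def padicLog {K : Type*} [NormedField K] (a : K) : K :=
  ∑' n : ℕ, padicLogTerm (a - 1) n

/-- The subset of `K` underlying an ideal of the ring of integers of `K`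
(the integral closure of `ℤ_[p]` in `K`). -/
def idealSet {p : ℕ} [Fact p.Prime] {K : Type*} [Field K] [Algebra ℤ_[p] K]
    (I : Ideal (integralClosure ℤ_[p] K)) : Set K :=
  {y | ∃ x ∈ I, y = (x : K)}

/-- The subset `1 + I` of `K`, for an ideal `I` of the ring of integers of `K`. -/
def oneAddSet {p : ℕ} [Fact p.Prime] {K : Type*} [Field K] [Algebra ℤ_[p] K]
    (I : Ideal (integralClosure ℤ_[p] K)) : Set K :=
  {a | ∃ x ∈ I, a = 1 + (x : K)}

open Filter Topology

/-! Put `ϖ = ζ - 1`. Evaluating the cyclotomic polynomial at 1 gives `‖ϖ‖ ^ (p - 1) = p⁻¹`, and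
expansion in powers of `ϖ` over `ℚ_[p]` shows that `ϖ` generates `𝔪` and that the residue field is
`𝔽_p`. The logarithm is the limit of `(a ^ p ^ m - 1) / p ^ m` (`tendsto_padicLog`), hence turns
products into sums and kills `ζ`. On `‖x‖ ≤ ‖ϖ‖ ^ 2` the map `x ↦ log (1 + x) - x` is a contraction,
so `log` maps `1 + 𝔪 ^ 2` onto `𝔪 ^ 2` (`norm_padicLog_le`, `exists_padicLog_eq`). Since `ζ ^ k ≡ 1
+ k ϖ` modulo `ϖ ^ 2`, each element of `1 + 𝔪` is some `ζ ^ k` times an element of `1 + 𝔪 ^ 2`, so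
its logarithm lies in `𝔪 ^ 2`. Conversely, multiplying a preimage in `1 + 𝔪 ^ 2` by `ζ` keeps its
logarithm and moves it out of `1 + 𝔪 ^ 2`. -/

theorem norm_padicLogTerm {K : Type*} [NormedField K] (x : K) (n : ℕ) :
    ‖padicLogTerm x n‖ = ‖x ^ (n + 1) / ((n : K) + 1)‖ := by
  simp [padicLogTerm]

/-! ### The logarithm as a limit of power maps -/

section PadicLogLimit

theorem summable_succ_mul_pow {r : ℝ} (h0 : 0 ≤ r) (h1 : r < 1) :
    Summable fun n : ℕ ↦ ((n : ℝ) + 1) * r ^ (n + 1) := by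
  have h := summable_pow_mul_geometric_of_norm_lt_one 1
    (by rwa [Real.norm_of_nonneg h0] : ‖r‖ < 1)
  have h' := (summable_nat_add_iff 1).2 h
  simpa using h'

variable (p : ℕ) [Fact p.Prime] {K : Type*} [NormedField K] [NormedAlgebra ℚ_[p] K]

include p

theorem norm_natCast_eq_padic_norm (n : ℕ) : ‖(n : K)‖ = ‖(n : ℚ_[p])‖ := by
  rw [← map_natCast (algebraMap ℚ_[p] K), norm_algebraMap']

theorem norm_prime_eq_inv : ‖(p : K)‖ = (p : ℝ)⁻¹ := by
  rw [norm_natCast_eq_padic_norm p, Padic.norm_p]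

theorem norm_natCast_le_one_of_padic (n : ℕ) : ‖(n : K)‖ ≤ 1 := by
  rw [norm_natCast_eq_padic_norm p]
  exact_mod_cast Padic.norm_int_le_one (p := p) n

theorem isUltrametricDist_of_padic_algebra : IsUltrametricDist K :=
  IsUltrametricDist.isUltrametricDist_of_forall_norm_natCast_le_one
    (norm_natCast_le_one_of_padic p)

theorem norm_natCast_eq_pow_padicValNat {n : ℕ} (hn : n ≠ 0) :
    ‖(n : K)‖ = ((p : ℝ)⁻¹) ^ padicValNat p n := by
  rw [norm_natCast_eq_padic_norm p, Padic.norm_eq_zpow_neg_valuation (by exact_mod_cast hn),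
    Padic.valuation_natCast, zpow_neg, zpow_natCast, inv_pow]

theorem inv_le_norm_natCast {n : ℕ} (hn : n ≠ 0) : (n : ℝ)⁻¹ ≤ ‖(n : K)‖ := by
  rw [norm_natCast_eq_pow_padicValNat p hn, inv_pow]
  have h : 0 < p ^ padicValNat p n := pow_pos (Fact.out : p.Prime).pos _
  exact inv_anti₀ (by exact_mod_cast h)
    (by exact_mod_cast Nat.le_of_dvd (Nat.pos_of_ne_zero hn) pow_padicValNat_dvd)

theorem natCast_ne_zero_of_padic {n : ℕ} (hn : n ≠ 0) : (n : K) ≠ 0 := by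
  rw [← norm_pos_iff]
  exact (inv_pos.2 (by positivity)).trans_le (inv_le_norm_natCast p hn)

theorem norm_pow_div_le (x : K) (n : ℕ) :
    ‖x ^ (n + 1) / ((n : K) + 1)‖ ≤ (n + 1) * ‖x‖ ^ (n + 1) := by
  have h := inv_le_norm_natCast p (K := K) n.succ_ne_zero
  push_cast at h
  rw [norm_div, norm_pow, div_eq_mul_inv, mul_comm]
  gcongr
  exact inv_le_of_inv_le₀ (by positivity) h

theorem tendsto_prime_pow_zero : Tendsto (fun m : ℕ ↦ (p : K) ^ m) atTop (𝓝 0) := by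
  apply tendsto_pow_atTop_nhds_zero_of_norm_lt_one
  rw [norm_prime_eq_inv p]
  exact inv_lt_one_of_one_lt₀ (by exact_mod_cast (Fact.out : p.Prime).one_lt)

/-- By Pascal's rule, consecutive coefficients sum to `(p ^ m).choose (k + 1)`, which carries a
factor `p ^ m / (k + 1)` and tends to 0. -/
theorem tendsto_choose_prime_pow_sub_one (k : ℕ) :
    Tendsto (fun m : ℕ ↦ ((p ^ m - 1).choose k : K)) atTop (𝓝 ((-1) ^ k)) := by
  induction k with
  | zero => simp
  | succ k ih =>
    have hk : ((k + 1 : ℕ) : K) ≠ 0 := natCast_ne_zero_of_padic p k.succ_ne_zero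
    have key : ∀ m : ℕ, ((p ^ m - 1).choose (k + 1) : K) =
        (p : K) ^ m * ((p ^ m - 1).choose k : K) / ((k + 1 : ℕ) : K)
          - ((p ^ m - 1).choose k : K) := by
      intro m
      have hm : p ^ m - 1 + 1 = p ^ m := Nat.sub_add_cancel (pow_pos (Fact.out : p.Prime).pos m)
      have h1 := Nat.add_one_mul_choose_eq (p ^ m - 1) k
      rw [Nat.choose_succ_succ, hm] at h1
      have h2 := congrArg (Nat.cast (R := K)) h1
      rw [eq_sub_iff_add_eq, eq_div_iff hk]
      push_cast at h2 ⊢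
      linear_combination -h2
    simp_rw [key]
    convert! (((tendsto_prime_pow_zero p (K := K)).mul ih).div_const ((k + 1 : ℕ) : K)).sub ih
      using 2
    ring

/-- The binomial theorem, with `(N - 1).choose k / (k + 1) = N.choose (k + 1) / N` for `N = p ^ m`.
-/
theorem tsum_choose_prime_pow (x : K) (m : ℕ) :
    ∑' k : ℕ, ((p ^ m - 1).choose k : K) * x ^ (k + 1) / ((k : K) + 1) =
      ((1 + x) ^ p ^ m - 1) / (p : K) ^ m := by
  have hp := (Fact.out : p.Prime)
  have hm : p ^ m - 1 + 1 = p ^ m := Nat.sub_add_cancel (pow_pos hp.pos m)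
  have hpm : (p : K) ^ m ≠ 0 := pow_ne_zero _ (natCast_ne_zero_of_padic p hp.ne_zero)
  rw [tsum_eq_sum (s := Finset.range (p ^ m)), add_comm 1 x, add_pow, Finset.sum_range_succ',
    eq_div_iff hpm, Finset.sum_mul]
  · simp only [one_pow, mul_one, pow_zero, Nat.choose_zero_right, Nat.cast_one, add_sub_cancel_right]
    refine Finset.sum_congr rfl fun k _ ↦ ?_
    have hk : ((k : K) + 1) ≠ 0 := by
      exact_mod_cast natCast_ne_zero_of_padic p (K := K) k.succ_ne_zero
    have h1 := Nat.add_one_mul_choose_eq (p ^ m - 1) k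
    rw [hm] at h1
    have h2 := congrArg (Nat.cast (R := K)) h1
    push_cast at h2
    field_simp
    linear_combination x ^ (k + 1) * h2
  · intro k hk
    rw [Nat.choose_eq_zero_of_lt (by simp at hk; omega)]
    simp

variable [CompleteSpace K]

theorem summable_padicLogTerm {x : K} (hx : ‖x‖ < 1) : Summable (padicLogTerm x) :=
  .of_norm_bounded (summable_succ_mul_pow (norm_nonneg x) hx) fun n ↦ by
    rw [norm_padicLogTerm]; exact norm_pow_div_le p x n

/-- Dominated convergence: the binomial coefficients have norm at most 1, so `norm_pow_div_le`
bounds the terms uniformly in `m`. -/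
theorem tendsto_padicLog {a : K} (ha : ‖a - 1‖ < 1) :
    Tendsto (fun m : ℕ ↦ (a ^ p ^ m - 1) / (p : K) ^ m) atTop (𝓝 (padicLog a)) := by
  have h := tendsto_tsum_of_dominated_convergence (𝓕 := atTop)
    (f := fun m k : ℕ ↦ ((p ^ m - 1).choose k : K) * (a - 1) ^ (k + 1) / ((k : K) + 1))
    (g := padicLogTerm (a - 1)) (summable_succ_mul_pow (norm_nonneg (a - 1)) ha)
    (fun k ↦ ((tendsto_choose_prime_pow_sub_one p k).mul_const _).div_const _)
    (.of_forall fun m k ↦ ?_)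
  · simpa only [tsum_choose_prime_pow p, add_sub_cancel, padicLog] using h
  · rw [mul_div_assoc, norm_mul]
    exact (mul_le_of_le_one_left (norm_nonneg _) (norm_natCast_le_one_of_padic p _)).trans
      (norm_pow_div_le p (a - 1) k)

theorem padicLog_mul {a b : K} (ha : ‖a - 1‖ < 1) (hb : ‖b - 1‖ < 1) :
    padicLog (a * b) = padicLog a + padicLog b := by
  have := isUltrametricDist_of_padic_algebra p (K := K)
  have hab : ‖a * b - 1‖ < 1 := by
    rw [show a * b - 1 = (a - 1) * (b - 1) + ((a - 1) + (b - 1)) by ring]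
    refine (IsUltrametricDist.norm_add_le_max _ _).trans_lt (max_lt ?_ ?_)
    · rw [norm_mul]
      exact mul_lt_one_of_nonneg_of_lt_one_left (norm_nonneg _) ha hb.le
    · exact (IsUltrametricDist.norm_add_le_max _ _).trans_lt (max_lt ha hb)
  refine tendsto_nhds_unique (tendsto_padicLog p hab) ?_
  -- In `(ab)^N - 1 = (a^N - 1)(b^N - 1) + (a^N - 1) + (b^N - 1)`, division by `N = p ^ m` leaves a
  -- spare factor `p ^ m` on the product, which therefore vanishes in the limit.
  have h := (((tendsto_prime_pow_zero p (K := K)).mul (tendsto_padicLog p ha)).mul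
    (tendsto_padicLog p hb)).add ((tendsto_padicLog p ha).add (tendsto_padicLog p hb))
  rw [zero_mul, zero_mul, zero_add] at h
  refine h.congr fun m ↦ ?_
  have hpm : (p : K) ^ m ≠ 0 :=
    pow_ne_zero _ (natCast_ne_zero_of_padic p (Fact.out : p.Prime).ne_zero)
  field_simp
  ring

theorem padicLog_eq_zero_of_pow_eq_one {a : K} (ha : ‖a - 1‖ < 1) (h : a ^ p = 1) :
    padicLog a = 0 := by
  refine tendsto_nhds_unique (tendsto_padicLog p ha) (tendsto_const_nhds.congr' ?_)
  filter_upwards [eventually_ge_atTop 1] with m hm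
  obtain ⟨k, rfl⟩ := Nat.exists_eq_add_of_le hm
  rw [pow_add p, pow_one, pow_mul, h, one_pow, sub_self, zero_div]

end PadicLogLimit

/-! ### The absolute value of `ζ - 1` -/

section Cyclotomic

variable (p : ℕ) [Fact p.Prime] {K : Type*} [NormedField K] [NormedAlgebra ℚ_[p] K]

include p

omit [NormedAlgebra ℚ_[p] K] in
theorem norm_eq_one_of_isPrimitiveRoot {ζ : K} (hζ : IsPrimitiveRoot ζ p) : ‖ζ‖ = 1 :=
  (pow_eq_one_iff_of_nonneg (norm_nonneg ζ) (Fact.out : p.Prime).ne_zero).1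
    (by rw [← norm_pow, hζ.pow_eq_one, norm_one])

theorem norm_pow_sub_one_le {a : K} (ha : ‖a‖ ≤ 1) (k : ℕ) : ‖a ^ k - 1‖ ≤ ‖a - 1‖ := by
  have := isUltrametricDist_of_padic_algebra p (K := K)
  rw [← geom_sum_mul, norm_mul]
  refine mul_le_of_le_one_left (norm_nonneg _) ?_
  refine IsUltrametricDist.norm_sum_le_of_forall_le_of_nonneg zero_le_one fun i _ ↦ ?_
  rw [norm_pow]
  exact pow_le_one₀ (norm_nonneg _) ha

/-- Each of the two roots is a power of the other. -/
theorem norm_sub_one_eq_of_isPrimitiveRoot {ζ μ : K} (hζ : IsPrimitiveRoot ζ p)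
    (hμ : IsPrimitiveRoot μ p) : ‖μ - 1‖ = ‖ζ - 1‖ := by
  have : NeZero p := ⟨(Fact.out : p.Prime).ne_zero⟩
  obtain ⟨k, -, rfl⟩ := hζ.eq_pow_of_pow_eq_one hμ.pow_eq_one
  obtain ⟨l, -, hl⟩ := hμ.eq_pow_of_pow_eq_one hζ.pow_eq_one
  refine le_antisymm (norm_pow_sub_one_le p (norm_eq_one_of_isPrimitiveRoot p hζ).le k) ?_
  conv_lhs => rw [← hl]
  exact norm_pow_sub_one_le p (norm_eq_one_of_isPrimitiveRoot p hμ).le l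

/-- The product of `1 - μ` over the `p - 1` primitive roots `μ` is `Φ_p(1) = p`, and all factors
have the same norm. -/
theorem norm_sub_one_pow_of_isPrimitiveRoot {ζ : K} (hζ : IsPrimitiveRoot ζ p) :
    ‖ζ - 1‖ ^ (p - 1) = (p : ℝ)⁻¹ := by
  have h := Polynomial.eval_one_cyclotomic_prime (R := K) (p := p)
  rw [Polynomial.cyclotomic_eq_prod_X_sub_primitiveRoots hζ, Polynomial.eval_prod] at h
  rw [← norm_prime_eq_inv p (K := K), ← h, norm_prod, ← Nat.totient_prime (Fact.out : p.Prime),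
    ← hζ.card_primitiveRoots, ← Finset.prod_const]
  refine Finset.prod_congr rfl fun μ hμ ↦ ?_
  rw [mem_primitiveRoots (Fact.out : p.Prime).pos] at hμ
  simp only [Polynomial.eval_sub, Polynomial.eval_X, Polynomial.eval_C]
  rw [norm_sub_rev 1 μ, norm_sub_one_eq_of_isPrimitiveRoot p hζ hμ]

end Cyclotomic

/-! ### Expansions in powers of the uniformizer -/

section Uniformizer

variable {p : ℕ} [Fact p.Prime] {K : Type*} [NormedField K] {ϖ : K}

theorem norm_pos_of_pow_eq_inv (hϖ : ‖ϖ‖ ^ (p - 1) = (p : ℝ)⁻¹) : 0 < ‖ϖ‖ := by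
  have hp := (Fact.out : p.Prime)
  refine (norm_nonneg _).lt_of_ne fun h ↦ ?_
  rw [← h, zero_pow (Nat.sub_pos_of_lt hp.one_lt).ne'] at hϖ
  exact (inv_pos.2 (by exact_mod_cast hp.pos : (0 : ℝ) < p)).ne hϖ

theorem norm_lt_one_of_pow_eq_inv (hϖ : ‖ϖ‖ ^ (p - 1) = (p : ℝ)⁻¹) : ‖ϖ‖ < 1 := by
  have hp := (Fact.out : p.Prime)
  by_contra! h
  have h1 := one_le_pow₀ h (n := p - 1)
  rw [hϖ] at h1
  exact absurd (inv_lt_one_of_one_lt₀ (by exact_mod_cast hp.one_lt : (1 : ℝ) < p)) h1.not_gt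

theorem inv_prime_le_norm (hϖ : ‖ϖ‖ ^ (p - 1) = (p : ℝ)⁻¹) : (p : ℝ)⁻¹ ≤ ‖ϖ‖ := by
  have hp := (Fact.out : p.Prime)
  rw [← hϖ]
  exact pow_le_of_le_one (norm_nonneg _) (norm_lt_one_of_pow_eq_inv hϖ).le
    (Nat.sub_pos_of_lt hp.one_lt).ne'

theorem padic_norm_le_inv_of_lt_one {a : ℚ_[p]} (ha : ‖a‖ < 1) : ‖a‖ ≤ (p : ℝ)⁻¹ := by
  have h := (Padic.norm_le_pow_iff_norm_lt_pow_add_one a (-1)).2 (by simpa using ha)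
  simpa using h

theorem padic_norm_le_one_of_lt_prime {a : ℚ_[p]} (ha : ‖a‖ < p) : ‖a‖ ≤ 1 := by
  have h := (Padic.norm_le_pow_iff_norm_lt_pow_add_one a 0).2 (by simpa using ha)
  simpa using h

theorem padic_norm_eq_zpow (hϖ : ‖ϖ‖ ^ (p - 1) = (p : ℝ)⁻¹) {a : ℚ_[p]} (ha : a ≠ 0) :
    ‖a‖ = ‖ϖ‖ ^ (((p - 1 : ℕ) : ℤ) * a.valuation) := by
  rw [Padic.norm_eq_zpow_neg_valuation ha, zpow_mul, zpow_natCast, hϖ, inv_zpow, zpow_neg]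

variable [NormedAlgebra ℚ_[p] K]

/-- The terms of an expansion in powers of `ϖ` have distinct absolute values. -/
theorem norm_coeff_mul_pow_le (hϖ : ‖ϖ‖ ^ (p - 1) = (p : ℝ)⁻¹) (a : ℕ → ℚ_[p]) {i : ℕ}
    (hi : i < p - 1) : ‖a i‖ * ‖ϖ‖ ^ i ≤ ‖∑ j ∈ Finset.range (p - 1), a j • ϖ ^ j‖ := by
  have := isUltrametricDist_of_padic_algebra p (K := K)
  have h0 := norm_pos_of_pow_eq_inv hϖ
  have h1 := norm_lt_one_of_pow_eq_inv hϖ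
  by_cases hai : a i = 0
  · simp [hai]
  classical
  have hs : ((Finset.range (p - 1)).filter (a · ≠ 0)).Nonempty := ⟨i, by simp [hi, hai]⟩
  have hsum : ∑ j ∈ Finset.range (p - 1), a j • ϖ ^ j =
      ∑ j ∈ (Finset.range (p - 1)).filter (a · ≠ 0), a j • ϖ ^ j := by
    refine (Finset.sum_filter_of_ne (p := (a · ≠ 0)) fun j _ hj h ↦ hj ?_).symm
    rw [h, zero_smul]
  have hpair : Set.Pairwise ((Finset.range (p - 1)).filter (a · ≠ 0) : Finset ℕ)
      fun j k ↦ ‖a j • ϖ ^ j‖ ≠ ‖a k • ϖ ^ k‖ := by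
    intro j hj k hk hjk h
    simp only [Finset.coe_filter, Finset.mem_range, Set.mem_ofPred_eq] at hj hk
    rw [norm_smul, norm_smul, norm_pow, norm_pow, padic_norm_eq_zpow hϖ hj.2,
      padic_norm_eq_zpow hϖ hk.2, ← zpow_natCast, ← zpow_natCast, ← zpow_add₀ h0.ne',
      ← zpow_add₀ h0.ne'] at h
    have h2 := zpow_right_injective₀ h0 h1.ne h
    apply hjk
    -- The exponents are `(p - 1) v + j` with `j < p - 1`, so reduction modulo `p - 1` recovers `j`.
    have h3 := congrArg (· % ((p - 1 : ℕ) : ℤ)) h2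
    simp only [Int.mul_add_emod_self_left] at h3
    rw [Int.emod_eq_of_lt (by positivity) (by exact_mod_cast hj.1),
      Int.emod_eq_of_lt (by positivity) (by exact_mod_cast hk.1)] at h3
    exact_mod_cast h3
  rw [hsum, IsUltrametricDist.norm_sum_eq_sup'_of_pairwise_ne hs hpair, ← norm_pow, ← norm_smul]
  exact Finset.le_sup' (fun j ↦ ‖a j • ϖ ^ j‖) (by simp [hi, hai])

theorem norm_coeff_le_one (hϖ : ‖ϖ‖ ^ (p - 1) = (p : ℝ)⁻¹) (a : ℕ → ℚ_[p]) {i : ℕ}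
    (hi : i < p - 1) (h : ‖∑ j ∈ Finset.range (p - 1), a j • ϖ ^ j‖ ≤ 1) : ‖a i‖ ≤ 1 := by
  have h0 := norm_pos_of_pow_eq_inv hϖ
  have h1 := norm_lt_one_of_pow_eq_inv hϖ
  by_cases hai : a i = 0
  · simp [hai]
  apply padic_norm_le_one_of_lt_prime
  have h2 : ‖a i‖ * ‖ϖ‖ ^ (p - 1) < 1 :=
    (mul_lt_mul_of_pos_left (pow_lt_pow_right_of_lt_one₀ h0 h1 hi) (norm_pos_iff.2 hai)).trans_le
      ((norm_coeff_mul_pow_le hϖ a hi).trans h)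
  rwa [hϖ, ← div_eq_mul_inv,
    div_lt_one (by exact_mod_cast (Fact.out : p.Prime).pos)] at h2

theorem exists_natCast_norm_sub_le {a : ℚ_[p]} (ha : ‖a‖ ≤ 1) :
    ∃ k : ℕ, ‖a - k‖ ≤ (p : ℝ)⁻¹ := by
  obtain ⟨k, -, hk⟩ := PadicInt.exists_mem_range (p := p) (⟨a, ha⟩ : ℤ_[p])
  refine ⟨k, padic_norm_le_inv_of_lt_one ?_⟩
  have h := PadicInt.mem_nonunits.1 ((IsLocalRing.mem_maximalIdeal _).1 hk)
  rw [PadicInt.norm_def] at h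
  exact h

/-- The residue field is `𝔽_p`: modulo `ϖ` only the constant coefficient, a `p`-adic integer,
survives. -/
theorem exists_natCast_norm_sub_le_uniformizer (hϖ : ‖ϖ‖ ^ (p - 1) = (p : ℝ)⁻¹) {x : K}
    {a : ℕ → ℚ_[p]} (hx : x = ∑ j ∈ Finset.range (p - 1), a j • ϖ ^ j) (h : ‖x‖ ≤ 1) :
    ∃ k : ℕ, ‖x - k‖ ≤ ‖ϖ‖ := by
  have := isUltrametricDist_of_padic_algebra p (K := K)
  have h0 := norm_pos_of_pow_eq_inv hϖ
  have h1 := norm_lt_one_of_pow_eq_inv hϖ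
  have hp := (Fact.out : p.Prime).one_lt
  rw [hx] at h
  obtain ⟨k, hk⟩ := exists_natCast_norm_sub_le (norm_coeff_le_one hϖ a (by omega : 0 < p - 1) h)
  refine ⟨k, ?_⟩
  obtain ⟨n, hn⟩ : ∃ n, p - 1 = n + 1 := ⟨p - 2, by omega⟩
  have hsplit : x - k = ∑ j ∈ Finset.range n, a (j + 1) • ϖ ^ (j + 1)
      + algebraMap ℚ_[p] K (a 0 - k) := by
    rw [hx, hn, Finset.sum_range_succ', map_sub, map_natCast, pow_zero, Algebra.algebraMap_eq_smul_one]
    ring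
  rw [hsplit]
  refine (IsUltrametricDist.norm_add_le_max _ _).trans (max_le ?_ ?_)
  · refine IsUltrametricDist.norm_sum_le_of_forall_le_of_nonneg h0.le fun j hj ↦ ?_
    rw [Finset.mem_range] at hj
    rw [norm_smul, norm_pow]
    exact (mul_le_of_le_one_left (by positivity)
      (norm_coeff_le_one hϖ a (by omega : j + 1 < p - 1) h)).trans
      (pow_le_of_le_one h0.le h1.le j.succ_ne_zero)
  · rw [norm_algebraMap']
    exact hk.trans (inv_prime_le_norm hϖ)

theorem norm_le_uniformizer_of_lt_one (hϖ : ‖ϖ‖ ^ (p - 1) = (p : ℝ)⁻¹) {x : K}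
    {a : ℕ → ℚ_[p]} (hx : x = ∑ j ∈ Finset.range (p - 1), a j • ϖ ^ j) (h : ‖x‖ < 1) :
    ‖x‖ ≤ ‖ϖ‖ := by
  have := isUltrametricDist_of_padic_algebra p (K := K)
  obtain ⟨k, hk⟩ := exists_natCast_norm_sub_le_uniformizer hϖ hx h.le
  have hk1 : ‖(k : K)‖ < 1 := by
    rw [show (k : K) = x + (k - x) by ring]
    refine (IsUltrametricDist.norm_add_le_max _ _).trans_lt (max_lt h ?_)
    rw [norm_sub_rev]
    exact hk.trans_lt (norm_lt_one_of_pow_eq_inv hϖ)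
  rw [show x = (x - k) + k by ring]
  refine (IsUltrametricDist.norm_add_le_max _ _).trans (max_le hk ?_)
  rw [norm_natCast_eq_padic_norm p] at hk1 ⊢
  exact (padic_norm_le_inv_of_lt_one hk1).trans (inv_prime_le_norm hϖ)

theorem exists_eq_sum_smul_pow [IsCyclotomicExtension {p} ℚ_[p] K] {ζ : K}
    (hζ : IsPrimitiveRoot ζ p) (x : K) :
    ∃ a : ℕ → ℚ_[p], x = ∑ j ∈ Finset.range (p - 1), a j • (ζ - 1) ^ j := by
  have hp := (Fact.out : p.Prime)
  have : NeZero p := ⟨hp.ne_zero⟩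
  -- An upper bound on the degree suffices, so irreducibility of `Φ_p` over `ℚ_[p]` is not needed.
  have hdim : (hζ.subOnePowerBasis ℚ_[p]).dim ≤ p - 1 := by
    rw [← (hζ.subOnePowerBasis ℚ_[p]).finrank, (hζ.powerBasis ℚ_[p]).finrank,
      hζ.powerBasis_dim ℚ_[p], ← Nat.totient_prime hp,
      ← Polynomial.natDegree_cyclotomic p ℚ_[p]]
    refine Polynomial.natDegree_le_of_dvd (minpoly.dvd _ _ ?_) (Polynomial.cyclotomic_ne_zero _ _)
    rw [Polynomial.aeval_def, Polynomial.eval₂_eq_eval_map, Polynomial.map_cyclotomic]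
    exact hζ.isRoot_cyclotomic hp.pos
  obtain ⟨f, hf, hx⟩ := (hζ.subOnePowerBasis ℚ_[p]).exists_eq_aeval x
  refine ⟨f.coeff, ?_⟩
  rw [hx, Polynomial.aeval_eq_sum_range' (hf.trans_le hdim)]
  simp [IsPrimitiveRoot.subOnePowerBasis_gen]

/-- With `v` the valuation of `n + 1`, Bernoulli gives `1 + v (p - 1) ≤ p ^ v ≤ n + 1`, hence `(p -
1) v ≤ n`. -/
theorem pow_norm_le_norm_natCast_succ (hϖ : ‖ϖ‖ ^ (p - 1) = (p : ℝ)⁻¹) (n : ℕ) :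
    ‖ϖ‖ ^ n ≤ ‖(n : K) + 1‖ := by
  have hp := (Fact.out : p.Prime)
  have h := norm_natCast_eq_pow_padicValNat p (K := K) n.succ_ne_zero
  push_cast at h
  rw [h, ← hϖ, ← pow_mul]
  refine pow_le_pow_of_le_one (norm_nonneg _) (norm_lt_one_of_pow_eq_inv hϖ).le ?_
  have h1 : p ^ padicValNat p (n + 1) ≤ n + 1 := Nat.le_of_dvd n.succ_pos pow_padicValNat_dvd
  have h2 := one_add_mul_sub_le_pow (a := (p : ℤ)) (by omega) (padicValNat p (n + 1))
  zify [hp.one_le]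
  have h3 : (p : ℤ) ^ padicValNat p (n + 1) ≤ n + 1 := by exact_mod_cast h1
  push_cast at h2 h3 ⊢
  linarith

end Uniformizer

/-! ### The logarithm on the ball of radius `‖ϖ‖ ^ 2` -/

section PadicLogBijective

variable {p : ℕ} [Fact p.Prime] {K : Type*} [NormedField K] [NormedAlgebra ℚ_[p] K]
  [CompleteSpace K] {ϖ : K}

theorem padicLog_one {K : Type*} [NormedField K] : padicLog (1 : K) = 0 := by
  simp [padicLog, padicLogTerm]

/-- `x ↦ log (1 + x) - x` is a contraction on the ball of radius `‖ϖ‖ ^ 2`. -/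
theorem norm_padicLog_sub_sub_le (hϖ : ‖ϖ‖ ^ (p - 1) = (p : ℝ)⁻¹) {x y : K}
    (hx : ‖x‖ ≤ ‖ϖ‖ ^ 2) (hy : ‖y‖ ≤ ‖ϖ‖ ^ 2) :
    ‖(padicLog (1 + x) - x) - (padicLog (1 + y) - y)‖ ≤ ‖ϖ‖ * ‖x - y‖ := by
  have := isUltrametricDist_of_padic_algebra p (K := K)
  have h0 := norm_pos_of_pow_eq_inv hϖ
  have h1 := norm_lt_one_of_pow_eq_inv hϖ
  have h2 : ‖ϖ‖ ^ 2 < 1 := pow_lt_one₀ h0.le h1 two_ne_zero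
  have hlog : ∀ z : K, ‖z‖ ≤ ‖ϖ‖ ^ 2 →
      HasSum (fun n ↦ padicLogTerm z (n + 1)) (padicLog (1 + z) - z) := fun z hz ↦ by
    have h := (hasSum_nat_add_iff' 1).2 (summable_padicLogTerm p (hz.trans_lt h2)).hasSum
    simpa [padicLog, padicLogTerm] using h
  have h := (hlog x hx).sub (hlog y hy)
  rw [← h.tsum_eq]
  refine IsUltrametricDist.norm_tsum_le_of_forall_le_of_nonneg (by positivity) fun n ↦ ?_
  have hn : ‖((n + 1 : ℕ) : K) + 1‖ ≥ ‖ϖ‖ ^ (n + 1) := pow_norm_le_norm_natCast_succ hϖ (n + 1)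
  have hn0 : 0 < ‖((n + 1 : ℕ) : K) + 1‖ := (pow_pos h0 _).trans_le hn
  have hpow : ‖x ^ (n + 1 + 1) - y ^ (n + 1 + 1)‖ ≤ (‖ϖ‖ ^ 2) ^ (n + 1) * ‖x - y‖ := by
    rw [← (Commute.all x y).geom_sum₂_mul, norm_mul]
    gcongr
    refine IsUltrametricDist.norm_sum_le_of_forall_le_of_nonneg (by positivity) fun i hi ↦ ?_
    rw [Finset.mem_range] at hi
    rw [norm_mul, norm_pow, norm_pow,
      show (‖ϖ‖ ^ 2) ^ (n + 1) = (‖ϖ‖ ^ 2) ^ i * (‖ϖ‖ ^ 2) ^ (n + 1 + 1 - 1 - i) by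
        rw [← pow_add]; congr 1; omega]
    gcongr
  have hterm : padicLogTerm x (n + 1) - padicLogTerm y (n + 1) =
      (-1) ^ (n + 1) * ((x ^ (n + 1 + 1) - y ^ (n + 1 + 1)) / (((n + 1 : ℕ) : K) + 1)) := by
    simp only [padicLogTerm]
    ring
  rw [hterm, norm_mul, norm_pow, norm_neg, norm_one, one_pow, one_mul, norm_div, div_le_iff₀ hn0]
  calc _ ≤ (‖ϖ‖ ^ 2) ^ (n + 1) * ‖x - y‖ := hpow
    _ = ‖ϖ‖ ^ (n + 1) * ‖x - y‖ * ‖ϖ‖ ^ (n + 1) := by ring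
    _ ≤ ‖ϖ‖ * ‖x - y‖ * ‖((n + 1 : ℕ) : K) + 1‖ := by
      gcongr
      exact pow_le_of_le_one h0.le h1.le n.succ_ne_zero

theorem norm_padicLog_sub_le (hϖ : ‖ϖ‖ ^ (p - 1) = (p : ℝ)⁻¹) {x : K} (hx : ‖x‖ ≤ ‖ϖ‖ ^ 2) :
    ‖padicLog (1 + x) - x‖ ≤ ‖ϖ‖ ^ 2 := by
  have h := norm_padicLog_sub_sub_le hϖ hx (y := 0) (by simp)
  simp only [add_zero, padicLog_one, sub_zero] at h
  exact h.trans ((mul_le_of_le_one_left (norm_nonneg _) (norm_lt_one_of_pow_eq_inv hϖ).le).trans hx)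

theorem norm_padicLog_le (hϖ : ‖ϖ‖ ^ (p - 1) = (p : ℝ)⁻¹) {x : K} (hx : ‖x‖ ≤ ‖ϖ‖ ^ 2) :
    ‖padicLog (1 + x)‖ ≤ ‖ϖ‖ ^ 2 := by
  have := isUltrametricDist_of_padic_algebra p (K := K)
  rw [← sub_add_cancel (padicLog (1 + x)) x]
  exact (IsUltrametricDist.norm_add_le_max _ _).trans (max_le (norm_padicLog_sub_le hϖ hx) hx)

/-- A solution is a fixed point of the contraction `x ↦ z - (log (1 + x) - x)` of a complete ball.
-/
theorem exists_padicLog_eq (hϖ : ‖ϖ‖ ^ (p - 1) = (p : ℝ)⁻¹) {z : K} (hz : ‖z‖ ≤ ‖ϖ‖ ^ 2) :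
    ∃ x : K, ‖x‖ ≤ ‖ϖ‖ ^ 2 ∧ padicLog (1 + x) = z := by
  have := isUltrametricDist_of_padic_algebra p (K := K)
  let s : Set K := Metric.closedBall 0 (‖ϖ‖ ^ 2)
  let f : K → K := fun x ↦ z - (padicLog (1 + x) - x)
  have hs : ∀ x, x ∈ s ↔ ‖x‖ ≤ ‖ϖ‖ ^ 2 := fun x ↦ mem_closedBall_zero_iff
  have hf : Set.MapsTo f s s := fun x hx ↦ by
    rw [hs] at hx ⊢
    simp only [f]
    rw [sub_eq_add_neg]
    refine (IsUltrametricDist.norm_add_le_max _ _).trans (max_le hz ?_)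
    rw [norm_neg]
    exact norm_padicLog_sub_le hϖ hx
  have hc : ContractingWith ‖ϖ‖₊ (hf.restrict f s s) := by
    refine ⟨norm_lt_one_of_pow_eq_inv hϖ, LipschitzWith.of_dist_le_mul fun x y ↦ ?_⟩
    rw [Subtype.dist_eq, Subtype.dist_eq, dist_eq_norm, dist_eq_norm, coe_nnnorm]
    simp only [Set.MapsTo.val_restrict_apply, f]
    rw [sub_sub_sub_cancel_left, norm_sub_rev]
    exact norm_padicLog_sub_sub_le hϖ ((hs _).1 x.2) ((hs _).1 y.2)
  obtain ⟨x, hx, hfix, -⟩ := hc.exists_fixedPoint' Metric.isClosed_closedBall.isComplete hf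
    ((hs 0).2 (by simp)) (edist_ne_top _ _)
  refine ⟨x, (hs x).1 hx, ?_⟩
  have h : z - (padicLog (1 + x) - x) = x := hfix
  linear_combination -h

end PadicLogBijective

/-! ### Removing the linear term by a root of unity -/

section RootsOfUnity

variable {p : ℕ} [Fact p.Prime] {K : Type*} [NormedField K] [NormedAlgebra ℚ_[p] K] {ζ : K}

theorem norm_pow_sub_one_sub_mul_le (hζ : IsPrimitiveRoot ζ p) (k : ℕ) :
    ‖ζ ^ k - 1 - k * (ζ - 1)‖ ≤ ‖ζ - 1‖ ^ 2 := by
  have := isUltrametricDist_of_padic_algebra p (K := K)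
  rw [← geom_sum_mul, ← sub_mul, norm_mul, sq]
  gcongr
  have h : ∑ i ∈ Finset.range k, ζ ^ i - k = ∑ i ∈ Finset.range k, (ζ ^ i - 1) := by simp
  rw [h]
  exact IsUltrametricDist.norm_sum_le_of_forall_le_of_nonneg (norm_nonneg _) fun i _ ↦
    norm_pow_sub_one_le p (norm_eq_one_of_isPrimitiveRoot p hζ).le i

variable [IsCyclotomicExtension {p} ℚ_[p] K]

/-- The exponent `k` represents the residue class of `(a - 1) / (ζ - 1)`. -/
theorem exists_norm_sub_pow_le (hζ : IsPrimitiveRoot ζ p) {a : K} (ha : ‖a - 1‖ ≤ ‖ζ - 1‖) :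
    ∃ k : ℕ, ‖a - ζ ^ k‖ ≤ ‖ζ - 1‖ ^ 2 := by
  have := isUltrametricDist_of_padic_algebra p (K := K)
  have hϖ := norm_sub_one_pow_of_isPrimitiveRoot p hζ
  have h0 := norm_pos_of_pow_eq_inv hϖ
  have hy : ‖(a - 1) / (ζ - 1)‖ ≤ 1 := by rwa [norm_div, div_le_one h0]
  obtain ⟨c, hc⟩ := exists_eq_sum_smul_pow hζ ((a - 1) / (ζ - 1))
  obtain ⟨k, hk⟩ := exists_natCast_norm_sub_le_uniformizer hϖ hc hy
  refine ⟨k, ?_⟩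
  have hne : ζ - 1 ≠ 0 := norm_pos_iff.1 h0
  rw [show a - ζ ^ k = ((a - 1) / (ζ - 1) - k) * (ζ - 1) - (ζ ^ k - 1 - k * (ζ - 1)) by
    field_simp; ring, sub_eq_add_neg]
  refine (IsUltrametricDist.norm_add_le_max _ _).trans (max_le ?_ ?_)
  · rw [norm_mul, sq]
    gcongr
  · rw [norm_neg]
    exact norm_pow_sub_one_sub_mul_le hζ k

theorem padicLog_image_eq [CompleteSpace K] (hζ : IsPrimitiveRoot ζ p) :
    padicLog '' {a : K | ‖a - 1‖ ≤ ‖ζ - 1‖ ∧ ¬ ‖a - 1‖ ≤ ‖ζ - 1‖ ^ 2} =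
      {z : K | ‖z‖ ≤ ‖ζ - 1‖ ^ 2} := by
  have := isUltrametricDist_of_padic_algebra p (K := K)
  have hϖ := norm_sub_one_pow_of_isPrimitiveRoot p hζ
  have h0 := norm_pos_of_pow_eq_inv hϖ
  have h1 := norm_lt_one_of_pow_eq_inv hϖ
  have h21 : ‖ζ - 1‖ ^ 2 < ‖ζ - 1‖ := by
    rw [sq]; exact mul_lt_of_lt_one_left h0 h1
  have hζ1 := norm_eq_one_of_isPrimitiveRoot p hζ
  have hlog : ∀ k : ℕ, padicLog (ζ ^ k) = 0 := fun k ↦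
    padicLog_eq_zero_of_pow_eq_one p ((norm_pow_sub_one_le p hζ1.le k).trans_lt h1)
      (by rw [← pow_mul, mul_comm, pow_mul, hζ.pow_eq_one, one_pow])
  have hmul : ∀ (k : ℕ) (b : K), ‖b - 1‖ ≤ ‖ζ - 1‖ ^ 2 →
      padicLog (ζ ^ k * b) = padicLog b := fun k b hb ↦ by
    rw [padicLog_mul p ((norm_pow_sub_one_le p hζ1.le k).trans_lt h1)
      (hb.trans_lt (h21.trans h1)), hlog, zero_add]
  apply Set.Subset.antisymm
  · rintro _ ⟨a, ⟨ha, -⟩, rfl⟩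
    obtain ⟨k, hk⟩ := exists_norm_sub_pow_le hζ ha
    have hζk : ζ ^ k ≠ 0 := norm_pos_iff.1 (by rw [norm_pow, hζ1, one_pow]; exact one_pos)
    have hb : ‖a / ζ ^ k - 1‖ ≤ ‖ζ - 1‖ ^ 2 := by
      rwa [div_sub_one hζk, norm_div, norm_pow, hζ1, one_pow, div_one]
    have h := norm_padicLog_le hϖ hb
    rwa [add_sub_cancel, ← hmul k _ hb, mul_div_cancel₀ _ hζk] at h
  · intro z hz
    obtain ⟨x, hx, hxz⟩ := exists_padicLog_eq hϖ hz
    have hx' : ‖ζ * x‖ ≤ ‖ζ - 1‖ ^ 2 := by rwa [norm_mul, hζ1, one_mul]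
    have hdec : ζ * (1 + x) - 1 = (ζ - 1) + ζ * x := by ring
    refine ⟨ζ * (1 + x), ⟨?_, fun h ↦ ?_⟩, ?_⟩
    · rw [hdec]
      exact (IsUltrametricDist.norm_add_le_max _ _).trans (max_le le_rfl (hx'.trans h21.le))
    · rw [hdec] at h
      -- Otherwise `ζ - 1` itself would lie in the smaller ball, as `ζ * x` does.
      have h' : ‖ζ - 1‖ ≤ ‖ζ - 1‖ ^ 2 := by
        conv_lhs => rw [show ζ - 1 = ((ζ - 1) + ζ * x) + -(ζ * x) by ring]
        exact (IsUltrametricDist.norm_add_le_max _ _).trans (max_le h (by rwa [norm_neg]))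
      exact absurd h21 h'.not_gt
    · have h := hmul 1 (1 + x) (by rwa [add_sub_cancel_left])
      rwa [pow_one, hxz] at h

end RootsOfUnity

/-! ### Integers and ideals in terms of the norm -/

section Integers

variable {p : ℕ} [Fact p.Prime] {K : Type*} [NormedField K] [NormedAlgebra ℚ_[p] K]
  [Algebra ℤ_[p] K] [IsScalarTower ℤ_[p] ℚ_[p] K] {ζ : K}

theorem norm_algebraMap_padicInt_le_one (c : ℤ_[p]) : ‖algebraMap ℤ_[p] K c‖ ≤ 1 := by
  rw [IsScalarTower.algebraMap_apply ℤ_[p] ℚ_[p] K, norm_algebraMap']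
  exact c.norm_le_one

/-- If `‖x‖ > 1`, the leading term of a monic integral equation strictly dominates the others. -/
theorem norm_le_one_of_isIntegral {x : K} (hx : IsIntegral ℤ_[p] x) : ‖x‖ ≤ 1 := by
  have := isUltrametricDist_of_padic_algebra p (K := K)
  obtain ⟨P, hP, hPx⟩ := hx
  by_contra! h
  rw [hP.as_sum, Polynomial.eval₂_add, Polynomial.eval₂_pow, Polynomial.eval₂_X,
    Polynomial.eval₂_finsetSum, add_eq_zero_iff_eq_neg] at hPx
  have hdeg : P.natDegree ≠ 0 := fun h0 ↦ by simp [h0] at hPx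
  obtain ⟨n, hn⟩ := Nat.exists_eq_succ_of_ne_zero hdeg
  have h1 := congrArg norm hPx
  rw [norm_neg, norm_pow, hn] at h1
  have h2 : ‖∑ i ∈ Finset.range n.succ, Polynomial.eval₂ (algebraMap ℤ_[p] K) x
      (Polynomial.C (P.coeff i) * Polynomial.X ^ i)‖ ≤ ‖x‖ ^ n := by
    refine IsUltrametricDist.norm_sum_le_of_forall_le_of_nonneg (by positivity) fun i hi ↦ ?_
    rw [Finset.mem_range_succ_iff] at hi
    rw [Polynomial.eval₂_mul, Polynomial.eval₂_C, Polynomial.eval₂_pow, Polynomial.eval₂_X,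
      norm_mul, norm_pow]
    exact (mul_le_of_le_one_left (by positivity) (norm_algebraMap_padicInt_le_one _)).trans
      (pow_le_pow_right₀ h.le hi)
  rw [← h1] at h2
  exact absurd (pow_lt_pow_right₀ h n.lt_succ_self) h2.not_gt

variable [IsCyclotomicExtension {p} ℚ_[p] K]

theorem isIntegral_iff_norm_le_one (hζ : IsPrimitiveRoot ζ p) {x : K} :
    IsIntegral ℤ_[p] x ↔ ‖x‖ ≤ 1 := by
  refine ⟨norm_le_one_of_isIntegral, fun hx ↦ ?_⟩
  have hp := (Fact.out : p.Prime)
  have hϖ := norm_sub_one_pow_of_isPrimitiveRoot p hζ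
  obtain ⟨a, rfl⟩ := exists_eq_sum_smul_pow hζ x
  refine IsIntegral.sum _ fun j hj ↦ ?_
  have haj := norm_coeff_le_one hϖ a (Finset.mem_range.1 hj) hx
  obtain ⟨c, hc⟩ : ∃ c : ℤ_[p], algebraMap ℤ_[p] ℚ_[p] c = a j := ⟨⟨a j, haj⟩, rfl⟩
  rw [← hc, Algebra.smul_def, ← IsScalarTower.algebraMap_apply]
  exact isIntegral_algebraMap.mul (((hζ.isIntegral hp.pos).tower_top.sub isIntegral_one).pow j)

/-- Integers of norm 1 are units, so `𝔪` lies in the proper ideal of elements of norm below 1;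
maximality forces equality. -/
theorem mem_maximal_iff_norm_lt_one (hζ : IsPrimitiveRoot ζ p)
    {𝔪 : Ideal (integralClosure ℤ_[p] K)} (h𝔪 : 𝔪.IsMaximal) {x : integralClosure ℤ_[p] K} :
    x ∈ 𝔪 ↔ ‖(x : K)‖ < 1 := by
  have := isUltrametricDist_of_padic_algebra p (K := K)
  have hle : ∀ y : integralClosure ℤ_[p] K, ‖(y : K)‖ ≤ 1 := fun y ↦
    norm_le_one_of_isIntegral y.2
  let I : Ideal (integralClosure ℤ_[p] K) :=
    { carrier := {y | ‖(y : K)‖ < 1}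
      zero_mem' := by simp
      add_mem' := fun {y z} hy hz ↦
        (IsUltrametricDist.norm_add_le_max (y : K) z).trans_lt (max_lt hy hz)
      smul_mem' := fun c y hy ↦ by
        have h : ‖(c : K) * y‖ < 1 := by
          rw [norm_mul]
          exact mul_lt_one_of_nonneg_of_lt_one_right (hle c) (norm_nonneg _) hy
        exact h }
  have hI : I ≠ ⊤ := by
    rw [Ideal.ne_top_iff_one]
    intro h
    have h' : ‖((1 : integralClosure ℤ_[p] K) : K)‖ < 1 := h
    simp at h'
  have hmI : 𝔪 ≤ I := fun y hy ↦ (hle y).lt_of_ne fun h1 ↦ h𝔪.ne_top <| by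
    have hy0 : (y : K) ≠ 0 := norm_pos_iff.1 (by rw [h1]; exact one_pos)
    have hinv : IsIntegral ℤ_[p] (y : K)⁻¹ :=
      (isIntegral_iff_norm_le_one hζ).2 (by rw [norm_inv, h1, inv_one])
    have hunit : (⟨(y : K)⁻¹, hinv⟩ : integralClosure ℤ_[p] K) * y = 1 :=
      Subtype.ext (inv_mul_cancel₀ hy0)
    rw [Ideal.eq_top_iff_one, ← hunit]
    exact 𝔪.mul_mem_left _ hy
  rw [h𝔪.eq_of_le hI hmI]
  rfl

theorem idealSet_span_singleton (hζ : IsPrimitiveRoot ζ p) {ϖ : integralClosure ℤ_[p] K}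
    (h0 : (ϖ : K) ≠ 0) : idealSet (Ideal.span {ϖ}) = {x : K | ‖x‖ ≤ ‖(ϖ : K)‖} := by
  ext x
  constructor
  · rintro ⟨y, hy, rfl⟩
    obtain ⟨c, rfl⟩ := Ideal.mem_span_singleton'.1 hy
    change ‖(c : K) * ϖ‖ ≤ ‖(ϖ : K)‖
    rw [norm_mul]
    exact mul_le_of_le_one_left (norm_nonneg _) (norm_le_one_of_isIntegral c.2)
  · intro hx
    have hc : IsIntegral ℤ_[p] (x / ϖ) := (isIntegral_iff_norm_le_one hζ).2 <| by
      rw [norm_div, div_le_one (norm_pos_iff.2 h0)]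
      exact hx
    exact ⟨⟨x / ϖ, hc⟩ * ϖ, Ideal.mem_span_singleton'.2 ⟨_, rfl⟩, (div_mul_cancel₀ x h0).symm⟩

theorem maximal_eq_span_zeta_sub_one (hζ : IsPrimitiveRoot ζ p)
    {𝔪 : Ideal (integralClosure ℤ_[p] K)} (h𝔪 : 𝔪.IsMaximal) (h : IsIntegral ℤ_[p] (ζ - 1)) :
    𝔪 = Ideal.span {(⟨ζ - 1, h⟩ : integralClosure ℤ_[p] K)} := by
  have hϖ := norm_sub_one_pow_of_isPrimitiveRoot p hζ
  have h0 : ζ - 1 ≠ 0 := norm_pos_iff.1 (norm_pos_of_pow_eq_inv hϖ)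
  apply le_antisymm
  · intro x hx
    rw [mem_maximal_iff_norm_lt_one hζ h𝔪] at hx
    obtain ⟨a, ha⟩ := exists_eq_sum_smul_pow hζ (x : K)
    have hx' : (x : K) ∈ idealSet (Ideal.span {(⟨ζ - 1, h⟩ : integralClosure ℤ_[p] K)}) := by
      rw [idealSet_span_singleton hζ h0]
      exact norm_le_uniformizer_of_lt_one hϖ ha hx
    obtain ⟨y, hy, hxy⟩ := hx'
    rwa [Subtype.ext hxy]
  · rw [Ideal.span_singleton_le_iff_mem, mem_maximal_iff_norm_lt_one hζ h𝔪]
    exact norm_lt_one_of_pow_eq_inv hϖ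

end Integers

theorem mem_oneAddSet_iff {p : ℕ} [Fact p.Prime] {K : Type*} [Field K] [Algebra ℤ_[p] K]
    {I : Ideal (integralClosure ℤ_[p] K)} {a : K} : a ∈ oneAddSet I ↔ a - 1 ∈ idealSet I := by
  simp only [oneAddSet, idealSet, Set.mem_ofPred_eq, sub_eq_iff_eq_add']

/-- `K = ℚ_p(ζ_p)` carries the absolute value extending that of `ℚ_p` (this is what
`NormedField` and `NormedAlgebra ℚ_[p] K` say), and `𝔪` is the maximal ideal of its ring of
integers. The logarithm series converges on `1 + 𝔪`, and the image of `(1 + 𝔪) \ (1 + 𝔪 ^ 2)`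
under the logarithm is `𝔪 ^ 2`. -/
theorem theorem2p1 (p : ℕ) [Fact p.Prime] (hp : 3 ≤ p)
    (K : Type*) [NormedField K] [NormedAlgebra ℚ_[p] K] [IsCyclotomicExtension {p} ℚ_[p] K]
    [Algebra ℤ_[p] K] [IsScalarTower ℤ_[p] ℚ_[p] K]
    (𝔪 : Ideal (integralClosure ℤ_[p] K)) (h𝔪 : 𝔪.IsMaximal) :
    (∀ a ∈ oneAddSet 𝔪, Summable (padicLogTerm (a - 1))) ∧
      padicLog '' (oneAddSet 𝔪 \ oneAddSet (𝔪 ^ 2)) = idealSet (𝔪 ^ 2) := by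
  have : NeZero p := ⟨(Fact.out : p.Prime).ne_zero⟩
  have : FiniteDimensional ℚ_[p] K := IsCyclotomicExtension.finiteDimensional {p} ℚ_[p] K
  have : CompleteSpace K := FiniteDimensional.complete ℚ_[p] K
  have hζ : IsPrimitiveRoot (IsCyclotomicExtension.zeta p ℚ_[p] K) p :=
    IsCyclotomicExtension.zeta_spec p ℚ_[p] K
  set ζ := IsCyclotomicExtension.zeta p ℚ_[p] K
  have hϖ := norm_sub_one_pow_of_isPrimitiveRoot p hζ
  have h1 := norm_lt_one_of_pow_eq_inv hϖ
  have h0 : ζ - 1 ≠ 0 := norm_pos_iff.1 (norm_pos_of_pow_eq_inv hϖ)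
  have hint : IsIntegral ℤ_[p] (ζ - 1) := (isIntegral_iff_norm_le_one hζ).2 h1.le
  have hset : idealSet 𝔪 = {x : K | ‖x‖ ≤ ‖ζ - 1‖} := by
    rw [maximal_eq_span_zeta_sub_one hζ h𝔪 hint, idealSet_span_singleton hζ h0]
  have hset2 : idealSet (𝔪 ^ 2) = {x : K | ‖x‖ ≤ ‖ζ - 1‖ ^ 2} := by
    rw [maximal_eq_span_zeta_sub_one hζ h𝔪 hint, Ideal.span_singleton_pow,
      idealSet_span_singleton hζ (pow_ne_zero 2 h0), ← norm_pow]
    rfl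
  refine ⟨fun a ha ↦ ?_, ?_⟩
  · rw [mem_oneAddSet_iff, hset] at ha
    exact summable_padicLogTerm p (lt_of_le_of_lt ha h1)
  · rw [hset2, ← padicLog_image_eq hζ]
    congr 1
    ext a
    rw [Set.mem_sdiff, mem_oneAddSet_iff, mem_oneAddSet_iff, hset, hset2]
    rfl
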